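/- Let $k:\mathbb{R}^d\times\mathbb{R}^d\to\mathbb{R}$ be a positive definite (symmetric) kernel that is bounded and has bounded first-order partial derivatives. Let $\mathcal{H}_k$ be its reproducing kernel Hilbert space, and let $\mathcal{H}_k^d$ be the space of vector fields with components in $\mathcal{H}_k$, with $\langle u,v\rangle_{\mathcal{H}_k^d}=\sum_{i=1}^d\langle u_i,v_i\rangle_{\mathcal{H}_k}$. For probability measures $\mu,\nu$ on $\mathbb{R}^d$ define the extended metric $$d_k^2(\mu,\nu)=\inf\Big\{\int_0^1\|v_t\|_{\mathcal{H}_k^d}^2\,\mathrm{d}t:\ \partial_t\rho_t+\nabla\cdot(\rho_tv_t)=0,\ \rho_0=\mu,\ \rho_1=\nu\Big\},$$ where $(\rho_t)_{t\in[0,1]}$ ranges over narrowly continuous curves of probability measures, $(v_t)_{t\in[0,1]}$ over measurable families in $\mathcal{H}_k^d$, and the continuity equation is understood weakly. If $d_k(\mu,\nu)<\infty$ and $(\rho_t,v_t)_{t\in[0,1]}$ realises the infimum, where $\rho_t$ has a density of class $C^1$ on $[0,1]\times\mathbb{R}^d$ and $v\in C_b^1([0,1]\times\mathbb{R}^d;\mathbb{R}^d)$,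 then the time-one flow map $F$ of $\frac{\mathrm{d}X_t}{\mathrm{d}t}=v_t(X_t)$ is called a Stein optimal transport map between $\mu$ and $\nu$. For a probability measure $\pi$, let $\mathcal{T}_{k,\pi}\nabla$ be the operator $\psi\mapsto\int_{\mathbb{R}^d}k(\cdot,y)\nabla\psi(y)\,\pi(\mathrm{d}y)$ from $C_c^\infty(\mathbb{R}^d)$ to $\mathcal{H}_k^d$, extended to $L^2(\pi)$ by closing its graph in $L^2(\pi)\times\mathcal{H}_k^d$ (if it is bounded from $L^2(\pi)$ to $\mathcal{H}_k^d$, this is its unique bounded extension; otherwise $\mathcal{T}_{k,\pi}\nabla\phi$ stands for any $w$ such that $(\phi,w)$ belongs to the closed graph). Fix $\varepsilon>0$ and let $(\pi_t)_{t\in(-\varepsilon,\varepsilon)}$ be a curve of probability measures on $\mathbb{R}^d$ such that $t\mapsto d_k(\pi_0,\pi_t)$ is finite and Lipschitz continuous. Assume that for every $t\in(-\varepsilon,\varepsilon)$ there exists a unique Stein optimal transport map $F_t$ between $\pi_0$ and $\pi_t$. Assume moreover that there exist $\phi_t\in L^2(\pi_t)$, $t\in(-\varepsilon,\varepsilon)$,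 solving the Stein–Poisson equations $$\nabla\cdot(\pi_t\,\mathcal{T}_{k,\pi_t}\nabla\phi_t)=-\partial_t\pi_t$$ in the sense of distributions on $\mathbb{R}^d$, that is, for every $t\in(-\varepsilon,\varepsilon)$ and every $\psi\in C_c^\infty(\mathbb{R}^d)$ the derivative $\frac{\mathrm{d}}{\mathrm{d}t}\int\psi\,\mathrm{d}\pi_t$ exists and equals $\int\nabla\psi\cdot\mathcal{T}_{k,\pi_t}\nabla\phi_t\,\mathrm{d}\pi_t$, and that $(-\varepsilon,\varepsilon)\ni t\mapsto\mathcal{T}_{k,\pi_t}\nabla\phi_t\in\mathcal{H}_k^d$ is continuous. Then, for every $x\in\mathbb{R}^d$, $$\frac{\mathrm{d}^+}{\mathrm{d}t}F_t(x)\Big|_{t=0}:=\lim_{t\to0^+}\frac{F_t(x)-x}{t}=(\mathcal{T}_{k,\pi_0}\nabla\phi_0)(x).$$ -/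

import Mathlib

open MeasureTheory Set Filter Topology
open scoped ENNReal NNReal ContDiff

noncomputable section

namespace SteinTransport

/-- The Euclidean space `ℝ^d`. -/
abbrev Space (d : ℕ) : Type := EuclideanSpace ℝ (Fin d)

/-- The `d`-fold Hilbert sum `H^d` of a Hilbert space `H` of functions, with
`⟪u, v⟫ = ∑ i, ⟪u i, v i⟫`; its elements are vector fields on `ℝ^d`. -/
abbrev VField (d : ℕ) (H : Type*) : Type _ := PiLp 2 (fun _ : Fin d => H)

/-- `ψ ∈ C_c^∞(ℝ^d)`. -/
def IsTest {d : ℕ} (ψ : Space d → ℝ) : Prop :=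
  ContDiff ℝ ∞ ψ ∧ HasCompactSupport ψ

/-- The kernel is bounded, and its first-order partial derivatives exist everywhere and are bounded.
(Kernels are symmetric, so derivatives in the first argument suffice.) -/
def IsBoundedC1Kernel {d : ℕ} (k : Space d → Space d → ℝ) : Prop :=
  (∃ C : ℝ, ∀ x y, |k x y| ≤ C) ∧
  ∃ C : ℝ, ∀ x y, ∀ i : Fin d,
    LineDifferentiableAt ℝ (fun x' => k x' y) x (EuclideanSpace.single i 1) ∧
    |lineDeriv ℝ (fun x' => k x' y) x (EuclideanSpace.single i 1)| ≤ C

section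

variable {d : ℕ} {H : Type*} [NormedAddCommGroup H] [InnerProductSpace ℝ H]
  [RKHS ℝ H (Space d) ℝ]

/-- The vector field `x ↦ (u_1(x), …, u_d(x))` given by `u ∈ H^d`. -/
def VField.eval (u : VField d H) (x : Space d) : Space d :=
  WithLp.toLp 2 (fun i => u i x)

variable (d H) in
/-- `H` is the reproducing kernel Hilbert space `H_k` of the kernel `k`. -/
def IsRKHSOf [CompleteSpace H] (k : Space d → Space d → ℝ) : Prop :=
  ∀ x y, RKHS.kernel H x y (1 : ℝ) = k x y

/-- The pairing `∫ ∇ψ · u dμ` of `-∇ · (μ u)` with a test function `ψ`. -/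
def fluxPairing (μ : ProbabilityMeasure (Space d)) (u : VField d H) (ψ : Space d → ℝ) : ℝ :=
  ∫ x, inner ℝ (gradient ψ x) (u.eval x) ∂(μ : Measure (Space d))

/-- `(ρ_t, v_t)` connects `μ` to `ν`: `ρ` is a narrowly continuous curve of probability measures on
`[0,1]` with `ρ_0 = μ` and `ρ_1 = ν`, `v` is a measurable time-dependent vector field with values
in `H^d`, and `∂_t ρ_t + ∇ · (ρ_t v_t) = 0` holds weakly, that is, for every test function `ψ` the
function `t ↦ ∫ ψ dρ_t` is absolutely continuous with derivative `∫ ∇ψ · v_t dρ_t`. -/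
structure IsConnecting (μ ν : ProbabilityMeasure (Space d))
    (ρ : ℝ → ProbabilityMeasure (Space d)) (v : ℝ → VField d H) : Prop where
  continuousOn : ContinuousOn ρ (Icc 0 1)
  start : ρ 0 = μ
  finish : ρ 1 = ν
  measurable : AEStronglyMeasurable v (volume.restrict (Icc (0 : ℝ) 1))
  integrable : ∀ ψ : Space d → ℝ, IsTest ψ →
    IntervalIntegrable (fun r => fluxPairing (ρ r) (v r) ψ) volume 0 1
  continuityEq : ∀ ψ : Space d → ℝ, IsTest ψ → ∀ s ∈ Icc (0 : ℝ) 1, ∀ t ∈ Icc (0 : ℝ) 1,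
    (∫ x, ψ x ∂(ρ t : Measure (Space d))) - ∫ x, ψ x ∂(ρ s : Measure (Space d)) =
      ∫ r in s..t, fluxPairing (ρ r) (v r) ψ

/-- The energy `∫_0^1 ‖v_t‖² dt`. -/
def energy (v : ℝ → VField d H) : ℝ≥0∞ :=
  ∫⁻ t in Icc (0 : ℝ) 1, ‖v t‖ₑ ^ 2

variable (H) in
/-- The squared Stein distance `d_k²(μ, ν)` (possibly infinite). -/
def steinDistSq (μ ν : ProbabilityMeasure (Space d)) : ℝ≥0∞ :=
  ⨅ (ρ : ℝ → ProbabilityMeasure (Space d)) (v : ℝ → VField d H) (_ : IsConnecting μ ν ρ v),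
    energy v

variable (H) in
/-- The extended Stein metric `d_k(μ, ν)`. -/
def steinDist (μ ν : ProbabilityMeasure (Space d)) : ℝ≥0∞ :=
  steinDistSq H μ ν ^ (1 / 2 : ℝ)

/-- `(ρ_t)_{t ∈ [0,1]}` has a (nonnegative) density that is `C¹` on `[0,1] × ℝ^d`. -/
def HasC1Density (ρ : ℝ → ProbabilityMeasure (Space d)) : Prop :=
  ∃ p : ℝ × Space d → ℝ, ContDiffOn ℝ 1 p (Icc (0 : ℝ) 1 ×ˢ univ) ∧
    ∀ t ∈ Icc (0 : ℝ) 1, (∀ x, 0 ≤ p (t, x)) ∧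
      (ρ t : Measure (Space d)) = volume.withDensity (fun x => ENNReal.ofReal (p (t, x)))

/-- `(t, x) ↦ v_t(x)` is of class `C_b^1([0,1] × ℝ^d; ℝ^d)`. -/
def IsCb1 (v : ℝ → VField d H) : Prop :=
  ContDiffOn ℝ 1 (fun z : ℝ × Space d => (v z.1).eval z.2) (Icc (0 : ℝ) 1 ×ˢ univ) ∧
  ∃ C : ℝ, ∀ z ∈ Icc (0 : ℝ) 1 ×ˢ (univ : Set (Space d)),
    ‖(v z.1).eval z.2‖ ≤ C ∧
    ‖fderivWithin ℝ (fun z : ℝ × Space d => (v z.1).eval z.2) (Icc (0 : ℝ) 1 ×ˢ univ) z‖ ≤ C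

/-- `F` is the time-one flow map of the differential equation `dX_t/dt = v_t(X_t)`. -/
def IsTimeOneFlow (v : ℝ → VField d H) (F : Space d → Space d) : Prop :=
  ∀ x, ∃ X : ℝ → Space d, X 0 = x ∧
    (∀ t ∈ Icc (0 : ℝ) 1, HasDerivWithinAt X ((v t).eval (X t)) (Icc (0 : ℝ) 1) t) ∧ F x = X 1

variable (H) in
/-- `F` is a Stein optimal transport map between `μ` and `ν`: `d_k(μ, ν) < ∞` and `F` is the
time-one flow map of a sufficiently regular geodesic connecting `μ` to `ν`. -/
def IsSteinOTMap (μ ν : ProbabilityMeasure (Space d)) (F : Space d → Space d) : Prop :=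
  steinDistSq H μ ν < ⊤ ∧
  ∃ (ρ : ℝ → ProbabilityMeasure (Space d)) (v : ℝ → VField d H),
    HasC1Density ρ ∧ IsCb1 v ∧
    IsConnecting μ ν ρ v ∧ energy v = steinDistSq H μ ν ∧ IsTimeOneFlow v F

/-- `w = 𝒯_{k,π} g`, where `𝒯_{k,π} g = ∫ k(·, y) g(y) π(dy)` componentwise. -/
def IsKernelIntegral (k : Space d → Space d → ℝ) (π : ProbabilityMeasure (Space d))
    (g : Space d → Space d) (w : VField d H) : Prop :=
  ∀ x, w.eval x = ∫ y, k x y • g y ∂(π : Measure (Space d))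

/-- `w = 𝒯_{k,π} ∇φ` for `φ ∈ L²(π)`. The operator `ψ ↦ 𝒯_{k,π} ∇ψ = ∫ k(·, y) ∇ψ(y) π(dy)` on
`C_c^∞(ℝ^d)` is extended to `L²(π)` by closing its graph in `L²(π) × H^d`; whenever it is bounded
from `L²(π)` to `H^d`, this is the graph of its unique bounded extension. -/
def IsKernelGradient (k : Space d → Space d → ℝ) (π : ProbabilityMeasure (Space d))
    (φ : Space d → ℝ) (w : VField d H) : Prop :=
  MemLp φ 2 (π : Measure (Space d)) ∧
  ∃ (ψ : ℕ → Space d → ℝ) (u : ℕ → VField d H),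
    (∀ n, IsTest (ψ n)) ∧
    (∀ n, IsKernelIntegral k π (gradient (ψ n)) (u n)) ∧
    Tendsto (fun n => eLpNorm (ψ n - φ) 2 (π : Measure (Space d))) atTop (𝓝 0) ∧
    Tendsto u atTop (𝓝 w)

/-- `∇ · (π_t w) = -∂_t π_t` at time `t` in the sense of distributions on `ℝ^d`: for every test
function `ψ`, the derivative of `s ↦ ∫ ψ dπ_s` at `t` exists and equals `∫ ∇ψ · w dπ_t`. -/
def TransportEqAt (π : ℝ → ProbabilityMeasure (Space d)) (w : VField d H) (t : ℝ) : Prop :=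
  ∀ ψ : Space d → ℝ, IsTest ψ →
    HasDerivAt (fun s => ∫ x, ψ x ∂(π s : Measure (Space d))) (fluxPairing (π t) w ψ) t

end

end SteinTransport

end

open SteinTransport

noncomputable section

namespace SteinTransport

section Eval

variable {d : ℕ} {H : Type*} [NormedAddCommGroup H] [InnerProductSpace ℝ H]
  [RKHS ℝ H (Space d) ℝ]

/-! Let `v` be the velocity of an optimal curve `ρ` from `π 0` to `π t`. The heart of the matter is
that `t⁻¹ • v` tends to `w 0` in L²([0,1]; H^d) as t → 0⁺, by expanding ‖t⁻¹ v - w 0‖² and bounding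
two terms.

Energy: the curve π itself, run over [0, t] and reparametrised, is a competitor with velocity t
w(ts), so optimality gives energy at most t²(‖w 0‖² + o(1)) (`steinDistSq_le`).

Cross term: by the reproducing property, the flux of `v s` against a test function ψ is the inner
product of `v s` with the kernel gradient of ψ under `ρ s` (`fluxPairing_eq_inner`). Its time
integral is the increment of ∫ ψ from `π 0` to `π t`, which the transport equation at 0 evaluates to
first order. Choose ψ with kernel gradient under `π 0` close to `w 0`, as the closed graph permits.
The kernel gradient under `ρ s` is also close, because small energy keeps `ρ s` near `π 0`
(`exists_norm_integral_sub_le`). Hence the mean of ⟨t⁻¹ v, w 0⟩ is at least ‖w 0‖² - o(1), and the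
square is o(1) (`eventually_integral_sq_norm_sub_le`).

Since evaluation is bounded on H^d uniformly in the point, the mean-square limit passes to the flow,
whose trajectory from x stays near x. -/

lemma eval_sub (u v : VField d H) (x : Space d) :
    (u - v).eval x = u.eval x - v.eval x := by
  ext i; simp [VField.eval]

lemma eval_smul (c : ℝ) (u : VField d H) (x : Space d) :
    (c • u).eval x = c • u.eval x := by
  ext i; simp [VField.eval]

end Eval

/-! ### Feature map, evaluation bounds and kernel gradients -/

section Kernel

variable {d : ℕ} {H : Type*} [NormedAddCommGroup H] [InnerProductSpace ℝ H]
  [CompleteSpace H] [RKHS ℝ H (Space d) ℝ]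

variable (H) in
/-- The canonical feature map `x ↦ k(·, x)`. -/
def feature (x : Space d) : H := RKHS.kerFun H x (1 : ℝ)

lemma inner_feature (u : H) (x : Space d) : inner ℝ u (feature H x) = u x := by
  simp [feature]

lemma inner_feature_feature {k : Space d → Space d → ℝ} (hH : IsRKHSOf d H k) (x y : Space d) :
    inner ℝ (feature H y) (feature H x) = k x y := by
  rw [inner_feature, feature, RKHS.kerFun_apply, hH]

/-- Moves one coordinate at a time, with the mean value inequality on each segment. Partial
derivatives need not be continuous, so no total derivative is available. -/
lemma abs_sub_add_sum_le {f : Space d → ℝ} {C : ℝ}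
    (hf : ∀ x, ∀ i : Fin d, LineDifferentiableAt ℝ f x (EuclideanSpace.single i 1) ∧
      |lineDeriv ℝ f x (EuclideanSpace.single i 1)| ≤ C) (x h : Space d) (S : Finset (Fin d)) :
    |f (x + ∑ i ∈ S, h i • EuclideanSpace.single i (1 : ℝ)) - f x| ≤ ∑ i ∈ S, C * |h i| := by
  induction S using Finset.induction_on with
  | empty => simp
  | insert i S hi ih =>
    rw [Finset.sum_insert hi, Finset.sum_insert hi]
    set z := x + ∑ i ∈ S, h i • EuclideanSpace.single i (1 : ℝ) with hz
    have key : |f (z + h i • EuclideanSpace.single i (1 : ℝ)) - f z| ≤ C * |h i| := by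
      have hd : ∀ s : ℝ, HasDerivAt (fun s : ℝ => f (z + s • EuclideanSpace.single i (1 : ℝ)))
          (lineDeriv ℝ f (z + s • EuclideanSpace.single i (1 : ℝ))
            (EuclideanSpace.single i (1 : ℝ))) s := by
        intro s
        have h1 := (hf (z + s • EuclideanSpace.single i (1 : ℝ)) i).1.hasLineDerivAt
        have h2 : HasDerivAt (fun t : ℝ => f (z + s • EuclideanSpace.single i (1 : ℝ) +
          t • EuclideanSpace.single i (1 : ℝ))) _ 0 := h1
        -- A line derivative is a derivative at 0; writing 0 as `s - s` lets a translation carry it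
        -- to `s`.
        have h3 : HasDerivAt (fun t : ℝ => f (z + s • EuclideanSpace.single i (1 : ℝ) +
          t • EuclideanSpace.single i (1 : ℝ)))
          (lineDeriv ℝ f (z + s • EuclideanSpace.single i (1 : ℝ))
            (EuclideanSpace.single i (1 : ℝ))) (s - s) := by rw [sub_self]; exact h2
        have h4 := h3.comp_sub_const s s
        have e : (fun t : ℝ => f (z + s • EuclideanSpace.single i (1 : ℝ) +
            (t - s) • EuclideanSpace.single i (1 : ℝ))) =
            fun t : ℝ => f (z + t • EuclideanSpace.single i (1 : ℝ)) := by
          funext t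
          rw [add_assoc, ← add_smul, add_sub_cancel]
        rwa [e] at h4
      have := Convex.norm_image_sub_le_of_norm_hasDerivWithin_le (s := univ)
        (fun s _ => (hd s).hasDerivWithinAt) (fun s _ => (hf _ i).2) convex_univ
        (mem_univ 0) (mem_univ (h i))
      simpa using this
    have e : x + (h i • EuclideanSpace.single i (1 : ℝ) +
        ∑ i ∈ S, h i • EuclideanSpace.single i (1 : ℝ)) =
        z + h i • EuclideanSpace.single i (1 : ℝ) := by rw [hz]; abel
    rw [e]
    have := abs_sub_le (f (z + h i • EuclideanSpace.single i (1 : ℝ))) (f z) (f x)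
    linarith

lemma abs_sub_le_of_lineDeriv_le {f : Space d → ℝ} {C : ℝ}
    (hf : ∀ x, ∀ i : Fin d, LineDifferentiableAt ℝ f x (EuclideanSpace.single i 1) ∧
      |lineDeriv ℝ f x (EuclideanSpace.single i 1)| ≤ C) (x y : Space d) :
    |f y - f x| ≤ d * (|C| * ‖y - x‖) := by
  have h := abs_sub_add_sum_le hf x (y - x) Finset.univ
  have e : x + ∑ i, (y - x) i • EuclideanSpace.single i (1 : ℝ) = y := by
    have := (EuclideanSpace.basisFun (Fin d) ℝ).sum_repr (y - x)
    simp only [EuclideanSpace.basisFun_repr, EuclideanSpace.basisFun_apply] at this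
    rw [this]; abel
  rw [e] at h
  refine h.trans ?_
  calc ∑ i, C * |(y - x) i| ≤ ∑ _i : Fin d, |C| * ‖y - x‖ := by
        refine Finset.sum_le_sum fun i _ => ?_
        have h1 : |(y - x) i| ≤ ‖y - x‖ := PiLp.norm_apply_le (y - x) i
        exact mul_le_mul (le_abs_self C) h1 (abs_nonneg _) (abs_nonneg _)
    _ = _ := by simp

lemma exists_norm_feature_le {k : Space d → Space d → ℝ} (hk : IsBoundedC1Kernel k)
    (hH : IsRKHSOf d H k) : ∃ κ : ℝ, 0 ≤ κ ∧ ∀ x : Space d, ‖feature H x‖ ≤ κ := by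
  obtain ⟨⟨C, hC⟩, -⟩ := hk
  refine ⟨√C, Real.sqrt_nonneg _, fun x => Real.le_sqrt_of_sq_le ?_⟩
  rw [← real_inner_self_eq_norm_sq, inner_feature_feature hH]
  exact (le_abs_self _).trans (hC x x)

/-- The squared distance of two features is k(x',x') - 2k(x,x') + k(x,x), a sum of two increments of
k in its first argument, each Lipschitz. The feature map is thus 1/2-Hölder. -/
lemma continuous_feature {k : Space d → Space d → ℝ} (hk : IsBoundedC1Kernel k)
    (hH : IsRKHSOf d H k) : Continuous (feature H : Space d → H) := by
  obtain ⟨-, C, hC⟩ := hk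
  have hL : ∀ x x' y, |k x' y - k x y| ≤ d * (|C| * ‖x' - x‖) := fun x x' y =>
    abs_sub_le_of_lineDeriv_le (f := fun x => k x y) (fun x i => hC x y i) x x'
  have hb : ∀ x x' : Space d,
      ‖feature H x' - feature H x‖ ^ 2 ≤ 2 * (d * (|C| * ‖x' - x‖)) := by
    intro x x'
    rw [← real_inner_self_eq_norm_sq]
    simp only [inner_sub_left, inner_sub_right, inner_feature_feature hH]
    have h1 := (abs_le.1 (hL x x' x')).2
    have h2 := (abs_le.1 (hL x x' x)).1
    linarith
  refine continuous_iff_continuousAt.2 fun x => ?_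
  rw [ContinuousAt, tendsto_iff_norm_sub_tendsto_zero]
  have h1 : Tendsto (fun x' : Space d => √(2 * (d * (|C| * ‖x' - x‖)))) (𝓝 x) (𝓝 0) := by
    have : Continuous (fun x' : Space d => √(2 * (d * (|C| * ‖x' - x‖)))) := by fun_prop
    simpa using this.tendsto x
  exact squeeze_zero (fun _ => norm_nonneg _) (fun x' => Real.le_sqrt_of_sq_le (hb x x')) h1

/-- Reproducing property and Cauchy–Schwarz in each component. -/
lemma norm_eval_le {κ : ℝ} (hκ : ∀ x : Space d, ‖feature H x‖ ≤ κ) (u : VField d H)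
    (x : Space d) : ‖u.eval x‖ ≤ κ * ‖u‖ := by
  have hκ0 : 0 ≤ κ := (norm_nonneg _).trans (hκ x)
  refine le_of_sq_le_sq ?_ (by positivity)
  rw [mul_pow, PiLp.norm_sq_eq_of_L2, PiLp.norm_sq_eq_of_L2, Finset.mul_sum]
  refine Finset.sum_le_sum fun i _ => ?_
  rw [← mul_pow]
  gcongr
  change ‖u i x‖ ≤ _
  rw [← inner_feature]
  refine (norm_inner_le_norm _ _).trans ?_
  rw [mul_comm]
  gcongr
  exact hκ x

lemma continuous_eval (hc : Continuous (feature H : Space d → H)) (u : VField d H) :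
    Continuous u.eval := by
  refine (PiLp.continuous_toLp 2 _).comp (continuous_pi fun i => ?_)
  simp_rw [← inner_feature]
  fun_prop

variable (H) in
/-- The vector field `∇ψ(y) k(·, y)`, as a function of `y`. -/
def gradFeature (ψ : Space d → ℝ) (y : Space d) : VField d H :=
  WithLp.toLp 2 (fun i => (gradient ψ y) i • feature H y)

lemma inner_gradFeature (u : VField d H) (ψ : Space d → ℝ) (y : Space d) :
    inner ℝ u (gradFeature H ψ y) = inner ℝ (gradient ψ y) (u.eval y) := by
  simp only [PiLp.inner_apply, gradFeature, VField.eval, real_inner_smul_right, inner_feature]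
  refine Finset.sum_congr rfl fun i _ => ?_
  simp [mul_comm]

lemma IsTest.continuous_gradient {ψ : Space d → ℝ} (hψ : IsTest ψ) :
    Continuous (gradient ψ) :=
  (InnerProductSpace.toDual ℝ (Space d)).symm.continuous.comp
    (hψ.1.continuous_fderiv (by simp))

lemma norm_gradient_eq (ψ : Space d → ℝ) (x : Space d) : ‖gradient ψ x‖ = ‖fderiv ℝ ψ x‖ := by
  simp [gradient]

lemma IsTest.hasCompactSupport_gradient {ψ : Space d → ℝ} (hψ : IsTest ψ) :
    HasCompactSupport (gradient ψ) :=
  (hψ.2.fderiv (𝕜 := ℝ)).comp_left (map_zero _)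

lemma IsTest.exists_norm_gradient_le {ψ : Space d → ℝ} (hψ : IsTest ψ) :
    ∃ K : ℝ, ∀ x, ‖gradient ψ x‖ ≤ K :=
  hψ.hasCompactSupport_gradient.exists_bound_of_continuous hψ.continuous_gradient

lemma IsTest.integrable {ψ : Space d → ℝ} (hψ : IsTest ψ) (μ : ProbabilityMeasure (Space d)) :
    Integrable ψ (μ : Measure (Space d)) :=
  hψ.1.continuous.integrable_of_hasCompactSupport hψ.2

lemma continuous_gradFeature (hc : Continuous (feature H : Space d → H)) {ψ : Space d → ℝ}
    (hψ : IsTest ψ) : Continuous (gradFeature H ψ) := by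
  have := hψ.continuous_gradient
  refine (PiLp.continuous_toLp 2 _).comp (continuous_pi fun i => ?_)
  fun_prop

lemma hasCompactSupport_gradFeature {ψ : Space d → ℝ} (hψ : IsTest ψ) :
    HasCompactSupport (gradFeature H ψ) := by
  refine hψ.hasCompactSupport_gradient.mono fun y hy h => hy ?_
  simp only [gradFeature, h, PiLp.zero_apply, zero_smul]
  rfl

lemma integrable_gradFeature (hc : Continuous (feature H : Space d → H)) {ψ : Space d → ℝ}
    (hψ : IsTest ψ) (μ : ProbabilityMeasure (Space d)) :
    Integrable (gradFeature H ψ) (μ : Measure (Space d)) :=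
  (continuous_gradFeature hc hψ).integrable_of_hasCompactSupport (hasCompactSupport_gradFeature hψ)

variable (H) in
/-- The vector field `𝒯_{k,μ} ∇ψ` as a Bochner integral in `H^d`. -/
def kernelGrad (μ : ProbabilityMeasure (Space d)) (ψ : Space d → ℝ) : VField d H :=
  ∫ y, gradFeature H ψ y ∂(μ : Measure (Space d))

/-- The kernel integral operator is adjoint to the inclusion of H^d into L²(μ). The weak continuity
equation thereby becomes a statement about inner products in H^d. -/
lemma fluxPairing_eq_inner (hc : Continuous (feature H : Space d → H)) {ψ : Space d → ℝ}
    (hψ : IsTest ψ) (μ : ProbabilityMeasure (Space d)) (u : VField d H) :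
    fluxPairing μ u ψ = inner ℝ u (kernelGrad H μ ψ) := by
  rw [kernelGrad, ← integral_inner (integrable_gradFeature hc hψ μ)]
  simp_rw [inner_gradFeature]
  rfl

/-- Elements of H are determined by their values, so the pointwise integral and the Bochner integral
agree. -/
lemma IsKernelIntegral.eq_kernelGrad (hc : Continuous (feature H : Space d → H))
    {k : Space d → Space d → ℝ} (hH : IsRKHSOf d H k) {ψ : Space d → ℝ}
    (hψ : IsTest ψ) {μ : ProbabilityMeasure (Space d)} {u : VField d H}
    (hu : IsKernelIntegral k μ (gradient ψ) u) : u = kernelGrad H μ ψ := by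
  have hi := integrable_gradFeature hc hψ μ
  ext i x
  have h2 : (kernelGrad H μ ψ) i x = ∫ y, k x y * (gradient ψ y) i ∂(μ : Measure (Space d)) := by
    have e : (kernelGrad H μ ψ) i = ∫ y, gradFeature H ψ y i ∂(μ : Measure (Space d)) :=
      ((PiLp.proj (𝕜 := ℝ) 2 (fun _ : Fin d => H) i).integral_comp_comm hi).symm
    have hi' : Integrable (fun y => gradFeature H ψ y i) (μ : Measure (Space d)) :=
      (PiLp.proj (𝕜 := ℝ) 2 (fun _ : Fin d => H) i).integrable_comp hi
    rw [e, ← inner_feature, real_inner_comm, ← integral_inner hi']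
    refine integral_congr_ae (.of_forall fun y => ?_)
    simp only [gradFeature, real_inner_smul_right]
    rw [real_inner_comm, inner_feature_feature hH, mul_comm]
  have h3 : u i x = ∫ y, k x y * (gradient ψ y) i ∂(μ : Measure (Space d)) := by
    have h4 : Integrable (fun y => k x y • gradient ψ y) (μ : Measure (Space d)) := by
      have hkc : Continuous (fun y => k x y) := by
        simp_rw [← inner_feature_feature hH]; fun_prop
      exact (hkc.smul hψ.continuous_gradient).integrable_of_hasCompactSupport
        hψ.hasCompactSupport_gradient.smul_left
    have h5 := congrArg (EuclideanSpace.proj (𝕜 := ℝ) i) (hu x)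
    rw [← (EuclideanSpace.proj (𝕜 := ℝ) i).integral_comp_comm h4] at h5
    exact h5
  rw [h3, h2]

lemma abs_fluxPairing_le {κ : ℝ} (hκ : ∀ x : Space d, ‖feature H x‖ ≤ κ) {ψ : Space d → ℝ} {K : ℝ}
    (hK : ∀ x, ‖gradient ψ x‖ ≤ K) (μ : ProbabilityMeasure (Space d)) (u : VField d H) :
    |fluxPairing μ u ψ| ≤ K * (κ * ‖u‖) := by
  have := norm_integral_le_of_norm_le_const (μ := (μ : Measure (Space d)))
    (f := fun x => inner ℝ (gradient ψ x) (u.eval x)) (C := K * (κ * ‖u‖))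
    (.of_forall fun x => (norm_inner_le_norm _ _).trans
      (mul_le_mul (hK x) (norm_eval_le hκ u x) (norm_nonneg _) ((norm_nonneg _).trans (hK x))))
  simpa [fluxPairing] using this

end Kernel

/-! ### Narrow convergence and quantitative closeness through test functions -/

section Narrow

variable {d : ℕ}

lemma exists_isTest_between {K G : Set (Space d)} (hK : IsCompact K) (hG : IsOpen G)
    (hKG : K ⊆ G) : ∃ ψ : Space d → ℝ, IsTest ψ ∧ (∀ x, 0 ≤ ψ x) ∧ (∀ x, ψ x ≤ 1) ∧
      (∀ x ∈ K, ψ x = 1) ∧ ∀ x ∉ G, ψ x = 0 := by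
  obtain ⟨L, hL, hKL, hLG⟩ := exists_compact_between hK hG hKG
  obtain ⟨f, hf0, hf1, hf⟩ := exists_contMDiffMap_zero_one_of_isClosed
    (n := ⊤) (modelWithCornersSelf ℝ (Space d)) (s := (interior L)ᶜ) (t := K)
    isOpen_interior.isClosed_compl hK.isClosed (disjoint_left.2 fun x hx hx' => hx (hKL hx'))
  refine ⟨f, ⟨f.contMDiff.contDiff, ?_⟩, fun x => (hf x).1, fun x => (hf x).2,
    fun x hx => hf1 hx, fun x hx => hf0 fun h => hx (hLG (interior_subset h))⟩
  refine HasCompactSupport.intro hL fun x hx => hf0 fun h => hx (interior_subset h)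

/-- Vague convergence of probability measures to a probability measure is narrow convergence. -/
lemma tendsto_of_forall_isTest {ι : Type*} {L : Filter ι} [L.IsCountablyGenerated]
    {μs : ι → ProbabilityMeasure (Space d)} {μ : ProbabilityMeasure (Space d)}
    (h : ∀ ψ : Space d → ℝ, IsTest ψ → Tendsto (fun i => ∫ x, ψ x ∂(μs i : Measure (Space d))) L
      (𝓝 (∫ x, ψ x ∂(μ : Measure (Space d))))) : Tendsto μs L (𝓝 μ) := by
  -- Portmanteau on open sets: inner regularity supplies a compact K in G with almost the mass of G,
  -- and a smooth bump between K and G transfers the bound.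
  refine tendsto_of_forall_isOpen_le_liminf' fun G hG => le_of_forall_lt fun r hr => ?_
  obtain ⟨r', hr, hr'⟩ := exists_between hr
  refine hr.trans_le ?_
  obtain ⟨K, hKG, hK, hrK⟩ := hG.exists_lt_isCompact hr'
  obtain ⟨ψ, hψ, h0, h1, hψK, hψG⟩ := exists_isTest_between hK hG hKG
  have hlow : r'.toReal < ∫ x, ψ x ∂(μ : Measure (Space d)) := by
    calc r'.toReal < (μ : Measure (Space d)).real K :=
          (ENNReal.toReal_lt_toReal hrK.ne_top (measure_ne_top _ _)).2 hrK
      _ = ∫ x, K.indicator 1 x ∂(μ : Measure (Space d)) :=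
          (integral_indicator_one hK.measurableSet).symm
      _ ≤ _ := by
          refine integral_mono ((integrable_indicator_iff hK.measurableSet).2
            (integrable_const (1 : ℝ)).integrableOn) (hψ.integrable μ) fun x => ?_
          by_cases hx : x ∈ K
          · simp [hx, hψK x hx]
          · simp [hx, h0 x]
  refine le_liminf_of_le (by isBoundedDefault) ?_
  filter_upwards [(h ψ hψ).eventually (lt_mem_nhds hlow)] with i hi
  have hup : ∫ x, ψ x ∂(μs i : Measure (Space d)) ≤ (μs i : Measure (Space d)).real G := by
    rw [← integral_indicator_one hG.measurableSet]
    refine integral_mono (hψ.integrable _) ((integrable_indicator_iff hG.measurableSet).2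
            (integrable_const (1 : ℝ)).integrableOn) fun x => ?_
    by_cases hx : x ∈ G
    · simp [hx, h1 x]
    · simp [hx, hψG x hx]
  exact (ENNReal.toReal_le_toReal hrK.ne_top (measure_ne_top _ _)).1 (hi.le.trans hup)

/-- Two probability measures that are close when tested against smooth Lipschitz functions are close
when tested against a fixed compactly supported continuous vector-valued function. -/
lemma exists_norm_integral_sub_le {V : Type*} [NormedAddCommGroup V] [InnerProductSpace ℝ V]
    [CompleteSpace V] {G : Space d → V} (hG : Continuous G) (hGs : HasCompactSupport G)
    {δ : ℝ} (hδ : 0 < δ) : ∃ M : ℝ, 0 ≤ M ∧ ∀ (μ ν : ProbabilityMeasure (Space d)) (η : ℝ),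
      (∀ f : Space d → ℝ, IsTest f → ∀ K : ℝ, (∀ x, ‖gradient f x‖ ≤ K) →
        |(∫ x, f x ∂(μ : Measure (Space d))) - ∫ x, f x ∂(ν : Measure (Space d))| ≤ K * η) →
      ‖(∫ x, G x ∂(μ : Measure (Space d))) - ∫ x, G x ∂(ν : Measure (Space d))‖ ≤
        δ + M * η := by
  obtain ⟨g, hg, hgG, hgs⟩ := hG.exists_contDiff_approx ⊤ (ε := fun _ => δ / 2) (by fun_prop)
    (fun _ => half_pos hδ)
  have hgs : HasCompactSupport g := hGs.mono hgs
  obtain ⟨M, hM⟩ := (hgs.fderiv (𝕜 := ℝ)).exists_bound_of_continuous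
    (hg.continuous_fderiv (by simp))
  refine ⟨M, (norm_nonneg _).trans (hM 0), fun μ ν η h => ?_⟩
  have hi : ∀ ρ : ProbabilityMeasure (Space d), Integrable g (ρ : Measure (Space d)) :=
    fun ρ => hg.continuous.integrable_of_hasCompactSupport hgs
  have hI : ∀ ρ : ProbabilityMeasure (Space d), Integrable G (ρ : Measure (Space d)) :=
    fun ρ => hG.integrable_of_hasCompactSupport hGs
  have hd : ∀ ρ : ProbabilityMeasure (Space d),
      ‖(∫ x, G x ∂(ρ : Measure (Space d))) - ∫ x, g x ∂(ρ : Measure (Space d))‖ ≤ δ / 2 := by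
    intro ρ
    rw [← integral_sub (hI ρ) (hi ρ)]
    have := norm_integral_le_of_norm_le_const (μ := (ρ : Measure (Space d)))
      (f := fun x => G x - g x) (C := δ / 2)
      (.of_forall fun x => by rw [← dist_eq_norm, dist_comm]; exact (hgG x).le)
    simpa using this
  -- A vector-valued difference is tested by the scalar function ⟨D, g⟩, which gives ‖D‖² ≤ ‖D‖ M η.
  set D := (∫ x, g x ∂(μ : Measure (Space d))) - ∫ x, g x ∂(ν : Measure (Space d)) with hD
  have hDle : ‖D‖ ≤ M * η := by
    have hf : IsTest (fun x => inner ℝ D (g x)) :=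
      ⟨contDiff_const.inner ℝ hg, hgs.comp_left (g := fun v => inner ℝ D v) (inner_zero_right _)⟩
    have h1 := h _ hf (‖D‖ * M) fun x => by
      rw [norm_gradient_eq]
      have hgx : HasFDerivAt g (fderiv ℝ g x) x :=
        (hg.differentiable (by simp) x).hasFDerivAt
      have h2 : HasFDerivAt (fun x => inner ℝ D (g x)) ((innerSL ℝ D).comp (fderiv ℝ g x)) x :=
        (innerSL ℝ D).hasFDerivAt.comp x hgx
      rw [h2.fderiv]
      refine (ContinuousLinearMap.opNorm_comp_le _ _).trans ?_
      rw [innerSL_apply_norm]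
      exact mul_le_mul_of_nonneg_left (hM x) (norm_nonneg _)
    rw [integral_inner (hi μ), integral_inner (hi ν), ← inner_sub_right, ← hD,
      real_inner_self_eq_norm_sq, abs_of_nonneg (sq_nonneg _)] at h1
    rcases eq_or_ne D 0 with h0 | h0
    -- The sign of η is not given; the zero test function yields 0 ≤ M η.
    · have h0' := h (fun _ => 0) ⟨contDiff_const, HasCompactSupport.zero⟩ M fun x => by
        simpa using (norm_nonneg _).trans (hM 0)
      rw [h0, norm_zero]
      simpa using h0'
    · have : 0 < ‖D‖ := norm_pos_iff.2 h0
      nlinarith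
  have h3 := hd μ
  have h4 := hd ν
  have e : (∫ x, G x ∂(μ : Measure (Space d))) - ∫ x, G x ∂(ν : Measure (Space d)) =
      ((∫ x, G x ∂(μ : Measure (Space d))) - ∫ x, g x ∂(μ : Measure (Space d))) + D -
      ((∫ x, G x ∂(ν : Measure (Space d))) - ∫ x, g x ∂(ν : Measure (Space d))) := by
    rw [hD]; abel
  rw [e]
  refine (norm_sub_le _ _).trans ?_
  have := norm_add_le ((∫ x, G x ∂(μ : Measure (Space d))) - ∫ x, g x ∂(μ : Measure (Space d))) D
  linarith

end Narrow

/-! ### Time integrals and the energy -/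

section Integral

/-- Nonnegativity of the variance of ‖v‖. -/
lemma sq_integral_norm_le {α V : Type*} [MeasurableSpace α] {ν : Measure α}
    [IsProbabilityMeasure ν] [NormedAddCommGroup V] {v : α → V} (hv : MemLp v 2 ν) :
    (∫ a, ‖v a‖ ∂ν) ^ 2 ≤ ∫ a, ‖v a‖ ^ 2 ∂ν := by
  have h1 : Integrable (fun a => ‖v a‖) ν := (hv.integrable one_le_two).norm
  have h2 : Integrable (fun a => ‖v a‖ ^ 2) ν := hv.integrable_norm_pow (by simp)
  set c := ∫ a, ‖v a‖ ∂ν with hc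
  have h3 : 0 ≤ ∫ a, (‖v a‖ - c) ^ 2 ∂ν := integral_nonneg fun a => sq_nonneg _
  have h4 : ∫ a, (‖v a‖ - c) ^ 2 ∂ν = (∫ a, ‖v a‖ ^ 2 ∂ν) - 2 * c * c + c ^ 2 := by
    have e : (fun a => (‖v a‖ - c) ^ 2) = fun a => ‖v a‖ ^ 2 - 2 * c * ‖v a‖ + c ^ 2 := by
      funext a; ring
    rw [e, integral_add (f := fun a => ‖v a‖ ^ 2 - 2 * c * ‖v a‖) (h2.sub (h1.const_mul _))
        (integrable_const _),
      integral_sub h2 (h1.const_mul _), integral_const_mul, ← hc]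
    simp
  nlinarith

instance : IsProbabilityMeasure (volume.restrict (Icc (0 : ℝ) 1)) := ⟨by simp⟩

lemma norm_intervalIntegral_le {E : Type*} [NormedAddCommGroup E] [NormedSpace ℝ E] {f : ℝ → E}
    {g : ℝ → ℝ} (hg : IntegrableOn g (Icc 0 1)) (hfg : ∀ r ∈ Icc (0 : ℝ) 1, ‖f r‖ ≤ g r)
    {s : ℝ} (hs : s ∈ Icc (0 : ℝ) 1) : ‖∫ r in (0 : ℝ)..s, f r‖ ≤ ∫ r in Icc 0 1, g r := by
  have hsub : Ioc 0 s ⊆ Icc (0 : ℝ) 1 := fun r hr => ⟨hr.1.le, hr.2.trans hs.2⟩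
  rw [intervalIntegral.integral_of_le hs.1]
  refine (norm_integral_le_of_norm_le (hg.mono_set hsub) ?_).trans
    (setIntegral_mono_set hg ?_ hsub.eventuallyLE)
  · exact (ae_restrict_mem measurableSet_Ioc).mono fun r hr => hfg r (hsub hr)
  · exact (ae_restrict_mem measurableSet_Icc).mono fun r hr => (norm_nonneg _).trans (hfg r hr)

end Integral

section Energy

variable {d : ℕ} {H : Type*} [NormedAddCommGroup H]

lemma memLp_of_energy_lt_top {v : ℝ → VField d H}
    (hm : AEStronglyMeasurable v (volume.restrict (Icc (0 : ℝ) 1))) (hv : energy v < ⊤) :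
    MemLp v 2 (volume.restrict (Icc (0 : ℝ) 1)) := by
  refine (memLp_two_iff_integrable_sq_norm hm).2 ⟨hm.norm.pow 2, ?_⟩
  rw [HasFiniteIntegral]
  simpa [energy, enorm_pow] using hv

lemma integral_sq_norm_eq_energy {v : ℝ → VField d H}
    (hm : AEStronglyMeasurable v (volume.restrict (Icc (0 : ℝ) 1))) :
    ∫ s in Icc (0 : ℝ) 1, ‖v s‖ ^ 2 = (energy v).toReal := by
  rw [integral_eq_lintegral_of_nonneg_ae (.of_forall fun s => sq_nonneg _) (hm.norm.pow 2), energy]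
  congr 1
  refine lintegral_congr fun s => ?_
  rw [ENNReal.ofReal_pow (norm_nonneg _), ofReal_norm]

lemma integral_norm_le_sqrt_energy {v : ℝ → VField d H}
    (hm : AEStronglyMeasurable v (volume.restrict (Icc (0 : ℝ) 1))) (hv : energy v < ⊤) :
    ∫ s in Icc (0 : ℝ) 1, ‖v s‖ ≤ √(energy v).toReal := by
  refine Real.le_sqrt_of_sq_le ?_
  rw [← integral_sq_norm_eq_energy hm]
  exact sq_integral_norm_le (memLp_of_energy_lt_top hm hv)

end Energy

/-! ### Narrow continuity from the transport equation -/

section TransportEq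

variable {d : ℕ} {H : Type*} [NormedAddCommGroup H] [InnerProductSpace ℝ H]
  [RKHS ℝ H (Space d) ℝ]

lemma continuousOn_of_transportEqAt {π : ℝ → ProbabilityMeasure (Space d)} {w : ℝ → VField d H}
    {S : Set ℝ} (hSP : ∀ t ∈ S, TransportEqAt π (w t) t) : ContinuousOn π S := fun t ht =>
  ContinuousAt.continuousWithinAt <|
    tendsto_of_forall_isTest fun ψ hψ => (hSP t ht ψ hψ).continuousAt

end TransportEq

/-! ### Energy estimates for connecting curves -/

section Connecting

variable {d : ℕ} {H : Type*} [NormedAddCommGroup H] [InnerProductSpace ℝ H]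
  [CompleteSpace H] [RKHS ℝ H (Space d) ℝ]

/-- Supplies the hypothesis of `exists_norm_integral_sub_le` with η = κ√(energy), uniformly in time.
-/
lemma IsConnecting.abs_integral_sub_le {κ : ℝ} (hκ : ∀ x : Space d, ‖feature H x‖ ≤ κ)
    {μ ν : ProbabilityMeasure (Space d)} {ρ : ℝ → ProbabilityMeasure (Space d)}
    {v : ℝ → VField d H} (hc : IsConnecting μ ν ρ v) (hE : energy v < ⊤)
    {s : ℝ} (hs : s ∈ Icc (0 : ℝ) 1) {f : Space d → ℝ} (hf : IsTest f) {K : ℝ}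
    (hK : ∀ x, ‖gradient f x‖ ≤ K) :
    |(∫ x, f x ∂(ρ s : Measure (Space d))) - ∫ x, f x ∂(μ : Measure (Space d))| ≤
      K * (κ * √(energy v).toReal) := by
  have hK0 : 0 ≤ K := (norm_nonneg _).trans (hK 0)
  have hκ0 : 0 ≤ κ := (norm_nonneg _).trans (hκ 0)
  have hi := (memLp_of_energy_lt_top hc.measurable hE).integrable one_le_two
  rw [← hc.start, hc.continuityEq f hf 0 (by simp) s hs]
  refine (norm_intervalIntegral_le (f := fun r => fluxPairing (ρ r) (v r) f)
    (g := fun r => K * (κ * ‖v r‖))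
    ((hi.norm.const_mul _).const_mul _)
    (fun r _ => abs_fluxPairing_le hκ hK (ρ r) (v r)) hs).trans ?_
  rw [integral_const_mul, integral_const_mul]
  gcongr
  exact integral_norm_le_sqrt_energy hc.measurable hE

/-- If the kernel gradients of a test function `ψ` along the curve stay close to a vector
field `u`, then the rescaled velocity is close to `u₀` in mean square as soon as the increment of
`∫ ψ` is large. -/
lemma IsConnecting.integral_sq_norm_sub_le (hcf : Continuous (feature H : Space d → H))
    {μ ν : ProbabilityMeasure (Space d)} {ρ : ℝ → ProbabilityMeasure (Space d)}
    {v : ℝ → VField d H} (hc : IsConnecting μ ν ρ v) (hE : energy v < ⊤)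
    {ψ : Space d → ℝ} (hψ : IsTest ψ) {u u₀ : VField d H} {c : ℝ}
    (hu : ∀ s ∈ Icc (0 : ℝ) 1, ‖kernelGrad H (ρ s) ψ - u‖ ≤ c) {t : ℝ} (ht : 0 < t) :
    ∫ s in Icc (0 : ℝ) 1, ‖t⁻¹ • v s - u₀‖ ^ 2 ≤
      (√(energy v).toReal / t) ^ 2 -
        2 * (((∫ x, ψ x ∂(ν : Measure (Space d))) - ∫ x, ψ x ∂(μ : Measure (Space d))) / t) +
        2 * ((‖u₀ - u‖ + c) * (√(energy v).toReal / t)) + ‖u₀‖ ^ 2 := by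
  have hLp := memLp_of_energy_lt_top hc.measurable hE
  have hi := hLp.integrable one_le_two
  have hsq : Integrable (fun s => ‖v s‖ ^ 2) (volume.restrict (Icc (0 : ℝ) 1)) :=
    hLp.integrable_norm_pow (by simp)
  have hc0 : 0 ≤ c := (norm_nonneg _).trans (hu 0 (by simp))
  have hin : Integrable (fun s => inner ℝ (v s) u₀) (volume.restrict (Icc (0 : ℝ) 1)) := by
    simpa only [real_inner_comm] using hi.const_inner u₀
  have hfl : Integrable (fun s => fluxPairing (ρ s) (v s) ψ)
      (volume.restrict (Icc (0 : ℝ) 1)) := by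
    have := (intervalIntegrable_iff_integrableOn_Icc_of_le zero_le_one).1 (hc.integrable ψ hψ)
    exact this
  have hD : (∫ x, ψ x ∂(ν : Measure (Space d))) - ∫ x, ψ x ∂(μ : Measure (Space d)) =
      ∫ s in Icc (0 : ℝ) 1, fluxPairing (ρ s) (v s) ψ := by
    have := hc.continuityEq ψ hψ 0 (by simp) 1 (by simp)
    rw [hc.start, hc.finish, intervalIntegral.integral_of_le zero_le_one,
      ← integral_Icc_eq_integral_Ioc] at this
    exact this
  -- Replacing the kernel gradient by `u₀` costs at most (‖u₀ - u‖ + c)‖v s‖, and the mean of ‖v‖ is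
  -- at most √(energy).
  have hlow : (∫ s in Icc (0 : ℝ) 1, fluxPairing (ρ s) (v s) ψ) -
      (‖u₀ - u‖ + c) * √(energy v).toReal ≤ ∫ s in Icc (0 : ℝ) 1, inner ℝ (v s) u₀ := by
    have h1 : ∫ s in Icc (0 : ℝ) 1, (fluxPairing (ρ s) (v s) ψ - (‖u₀ - u‖ + c) * ‖v s‖) ≤
        ∫ s in Icc (0 : ℝ) 1, inner ℝ (v s) u₀ := by
      refine setIntegral_mono_on (hfl.sub (hi.norm.const_mul _)) hin measurableSet_Icc
        fun s hs => ?_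
      rw [fluxPairing_eq_inner hcf hψ]
      have h2 : inner ℝ (v s) (kernelGrad H (ρ s) ψ) - inner ℝ (v s) u₀ =
          inner ℝ (v s) ((kernelGrad H (ρ s) ψ - u) - (u₀ - u)) := by
        rw [← inner_sub_right]; congr 1; abel
      have h3 := real_inner_le_norm (v s) ((kernelGrad H (ρ s) ψ - u) - (u₀ - u))
      have h4 := norm_sub_le (kernelGrad H (ρ s) ψ - u) (u₀ - u)
      have h5 := mul_le_mul_of_nonneg_left (h4.trans (add_le_add_left (hu s hs) _))
        (norm_nonneg (v s))
      linarith
    rw [integral_sub hfl (hi.norm.const_mul _), integral_const_mul] at h1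
    have h6 := mul_le_mul_of_nonneg_left (integral_norm_le_sqrt_energy hc.measurable hE)
      (add_nonneg (norm_nonneg (u₀ - u)) hc0)
    linarith
  have hexp : ∫ s in Icc (0 : ℝ) 1, ‖t⁻¹ • v s - u₀‖ ^ 2 =
      t⁻¹ ^ 2 * (energy v).toReal - 2 * t⁻¹ * (∫ s in Icc (0 : ℝ) 1, inner ℝ (v s) u₀) +
        ‖u₀‖ ^ 2 := by
    have e : (fun s => ‖t⁻¹ • v s - u₀‖ ^ 2) = fun s =>
        (t⁻¹ ^ 2 * ‖v s‖ ^ 2 - 2 * t⁻¹ * inner ℝ (v s) u₀) + ‖u₀‖ ^ 2 := by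
      funext s
      rw [norm_sub_sq_real, norm_smul, real_inner_smul_left, mul_pow, Real.norm_eq_abs, sq_abs]
      ring
    rw [e, integral_add (f := fun s => t⁻¹ ^ 2 * ‖v s‖ ^ 2 - 2 * t⁻¹ * inner ℝ (v s) u₀)
      ((hsq.const_mul _).sub (hin.const_mul _)) (integrable_const _),
      integral_sub (hsq.const_mul _) (hin.const_mul _), integral_const_mul, integral_const_mul,
      integral_sq_norm_eq_energy hc.measurable]
    simp
  rw [hexp, hD, div_pow, Real.sq_sqrt ENNReal.toReal_nonneg]
  have h7 := mul_le_mul_of_nonneg_left hlow (inv_pos.2 ht).le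
  simp only [div_eq_mul_inv]
  have h8 : (t ^ 2)⁻¹ = t⁻¹ ^ 2 := (inv_pow t 2).symm
  rw [h8]
  linarith

/-- Freeze the velocity at `r₀`: narrow convergence handles the moving measure, and the uniform flux
bound handles the change of velocity. -/
lemma continuousOn_fluxPairing {κ : ℝ} (hκ : ∀ x : Space d, ‖feature H x‖ ≤ κ)
    (hcf : Continuous (feature H : Space d → H)) {π : ℝ → ProbabilityMeasure (Space d)}
    {w : ℝ → VField d H} {S : Set ℝ} (hπ : ContinuousOn π S) (hw : ContinuousOn w S)
    {ψ : Space d → ℝ} (hψ : IsTest ψ) :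
    ContinuousOn (fun r => fluxPairing (π r) (w r) ψ) S := by
  intro r₀ hr₀
  obtain ⟨K, hK⟩ := hψ.exists_norm_gradient_le
  have hg : Continuous fun x => inner ℝ (gradient ψ x) ((w r₀).eval x) :=
    hψ.continuous_gradient.inner (continuous_eval hcf _)
  have h1 : Tendsto (fun r => fluxPairing (π r) (w r₀) ψ) (𝓝[S] r₀)
      (𝓝 (fluxPairing (π r₀) (w r₀) ψ)) :=
    ProbabilityMeasure.tendsto_iff_forall_integral_tendsto.1 (hπ r₀ hr₀)
      (BoundedContinuousFunction.ofNormedAddCommGroup _ hg (K * (κ * ‖w r₀‖)) fun x =>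
        (norm_inner_le_norm _ _).trans
          (mul_le_mul (hK x) (norm_eval_le hκ _ x) (norm_nonneg _) ((norm_nonneg _).trans (hK x))))
  have h2 : Tendsto (fun r => fluxPairing (π r) (w r - w r₀) ψ) (𝓝[S] r₀) (𝓝 0) := by
    refine squeeze_zero_norm (fun r => abs_fluxPairing_le hκ hK (π r) (w r - w r₀)) ?_
    have h3 : Tendsto (fun r => w r - w r₀) (𝓝[S] r₀) (𝓝 (w r₀ - w r₀)) :=
      (hw r₀ hr₀).sub tendsto_const_nhds
    simpa using ((h3.norm.const_mul κ).const_mul K)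
  have h4 := h1.add h2
  rw [add_zero] at h4
  refine h4.congr fun r => ?_
  simp only [fluxPairing_eq_inner hcf hψ, inner_sub_left]
  ring

/-- A curve driven by a continuous velocity on `[0, t]` bounds the Stein distance of its
endpoints. -/
lemma steinDistSq_le {κ : ℝ} (hκ : ∀ x : Space d, ‖feature H x‖ ≤ κ)
    (hcf : Continuous (feature H : Space d → H)) {π : ℝ → ProbabilityMeasure (Space d)}
    {w : ℝ → VField d H} {t B : ℝ} (ht : 0 ≤ t)
    (hSP : ∀ r ∈ Icc 0 t, TransportEqAt π (w r) r) (hw : ContinuousOn w (Icc 0 t))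
    (hB : ∀ r ∈ Icc 0 t, ‖w r‖ ≤ B) :
    steinDistSq H (π 0) (π t) ≤ ENNReal.ofReal ((t * B) ^ 2) := by
  have hmaps : MapsTo (fun s => t * s) (Icc (0 : ℝ) 1) (Icc 0 t) := fun s hs =>
    ⟨mul_nonneg ht hs.1, mul_le_of_le_one_right ht hs.2⟩
  have hmul : ContinuousOn (fun s : ℝ => t * s) (Icc (0 : ℝ) 1) := by fun_prop
  have hπ := continuousOn_of_transportEqAt hSP
  have hv : ContinuousOn (fun s => t • w (t * s)) (Icc (0 : ℝ) 1) :=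
    (hw.comp hmul hmaps).const_smul t
  have hflux : ∀ ψ : Space d → ℝ, IsTest ψ → ContinuousOn
      (fun r => fluxPairing (π (t * r)) (t • w (t * r)) ψ) (Icc 0 1) := fun ψ hψ =>
    continuousOn_fluxPairing hκ hcf (hπ.comp hmul hmaps) hv hψ
  have hconn : IsConnecting (π 0) (π t) (fun s => π (t * s)) (fun s => t • w (t * s)) := by
    refine ⟨hπ.comp hmul hmaps, by simp, by simp, ?_, ?_, ?_⟩
    · exact hv.aestronglyMeasurable_of_isCompact isCompact_Icc measurableSet_Icc
    · intro ψ hψ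
      refine ContinuousOn.intervalIntegrable ?_
      rw [uIcc_of_le zero_le_one]
      exact hflux ψ hψ
    · intro ψ hψ a ha b hb
      have hab : uIcc a b ⊆ Icc 0 1 := uIcc_subset_Icc ha hb
      refine (intervalIntegral.integral_eq_sub_of_hasDerivAt
        (f := fun s => ∫ x, ψ x ∂(π (t * s) : Measure (Space d))) (fun s hs => ?_)
        ((hflux ψ hψ).mono hab).intervalIntegrable).symm
      have h1 := hSP (t * s) (hmaps (hab hs)) ψ hψ
      have h2 : HasDerivAt (fun s : ℝ => t * s) t s := by simpa using (hasDerivAt_id s).const_mul t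
      have h3 := h1.comp s h2
      have e : fluxPairing (π (t * s)) (t • w (t * s)) ψ =
          fluxPairing (π (t * s)) (w (t * s)) ψ * t := by
        rw [fluxPairing_eq_inner hcf hψ, fluxPairing_eq_inner hcf hψ, real_inner_smul_left, mul_comm]
      rw [e]
      exact h3
  have hle : steinDistSq H (π 0) (π t) ≤ energy (fun s => t • w (t * s)) :=
    iInf_le_of_le _ (iInf_le_of_le _ (iInf_le _ hconn))
  refine hle.trans ?_
  calc energy (fun s => t • w (t * s))
      ≤ ∫⁻ _ in Icc (0 : ℝ) 1, ENNReal.ofReal ((t * B) ^ 2) := by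
        refine setLIntegral_mono' measurableSet_Icc fun s hs => ?_
        rw [← ofReal_norm, ← ENNReal.ofReal_pow (norm_nonneg _)]
        refine ENNReal.ofReal_le_ofReal (pow_le_pow_left₀ (norm_nonneg _) ?_ 2)
        rw [norm_smul, Real.norm_of_nonneg ht]
        exact mul_le_mul_of_nonneg_left (hB _ (hmaps hs)) ht
    _ = _ := by simp

lemma eventually_steinDistSq_le {κ : ℝ} (hκ : ∀ x : Space d, ‖feature H x‖ ≤ κ)
    (hcf : Continuous (feature H : Space d → H)) {ε : ℝ} (hε : 0 < ε)
    {π : ℝ → ProbabilityMeasure (Space d)} {w : ℝ → VField d H}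
    (hSP : ∀ t ∈ Ioo (-ε) ε, TransportEqAt π (w t) t) (hcont : ContinuousOn w (Ioo (-ε) ε))
    {η : ℝ} (hη : 0 < η) :
    ∀ᶠ t in 𝓝[>] (0 : ℝ), (steinDistSq H (π 0) (π t)).toReal ≤ t ^ 2 * (‖w 0‖ ^ 2 + η) := by
  have h0 : Ioo (-ε) ε ∈ 𝓝 (0 : ℝ) := Ioo_mem_nhds (by linarith) hε
  have hw0 : ContinuousAt w 0 := hcont.continuousAt h0
  have h1 : ∀ᶠ r in 𝓝 (0 : ℝ), ‖w r‖ ^ 2 < ‖w 0‖ ^ 2 + η :=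
    (show ContinuousAt (fun r => ‖w r‖ ^ 2) 0 from hw0.norm.pow 2).eventually
      (gt_mem_nhds (by linarith))
  obtain ⟨δ, hδ, hball⟩ := Metric.eventually_nhds_iff.1 (h1.and h0)
  filter_upwards [Ioo_mem_nhdsGT hδ] with t ht
  have hmem : ∀ r ∈ Icc 0 t, ‖w r‖ ^ 2 < ‖w 0‖ ^ 2 + η ∧ r ∈ Ioo (-ε) ε := fun r hr =>
    hball (by rw [Real.dist_0_eq_abs, abs_of_nonneg hr.1]; exact hr.2.trans_lt ht.2)
  have h2 := steinDistSq_le hκ hcf (B := √(‖w 0‖ ^ 2 + η)) ht.1.le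
    (fun r hr => hSP r (hmem r hr).2) (hcont.mono fun r hr => (hmem r hr).2)
    (fun r hr => Real.le_sqrt_of_sq_le (hmem r hr).1.le)
  rw [mul_pow, Real.sq_sqrt (by positivity)] at h2
  have h3 := ENNReal.toReal_mono ENNReal.ofReal_ne_top h2
  rwa [ENNReal.toReal_ofReal (by positivity)] at h3

end Connecting

/-! ### Mean-square convergence of optimal velocities, and displacement of trajectories -/

section Minimizer

variable {d : ℕ} {H : Type*} [NormedAddCommGroup H] [InnerProductSpace ℝ H]
  [CompleteSpace H] [RKHS ℝ H (Space d) ℝ]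

/-- The rescaled velocities of energy-minimising curves from `π 0` to `π t` converge in mean square
to `w 0` as `t → 0⁺`. -/
lemma eventually_integral_sq_norm_sub_le {κ : ℝ} (hκ : ∀ x : Space d, ‖feature H x‖ ≤ κ)
    (hcf : Continuous (feature H : Space d → H)) {k : Space d → Space d → ℝ}
    (hH : IsRKHSOf d H k) {ε : ℝ} (hε : 0 < ε)
    {π : ℝ → ProbabilityMeasure (Space d)} {φ : Space d → ℝ} {w : ℝ → VField d H}
    (hw : IsKernelGradient k (π 0) φ (w 0))
    (hSP : ∀ t ∈ Ioo (-ε) ε, TransportEqAt π (w t) t) (hcont : ContinuousOn w (Ioo (-ε) ε))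
    {η : ℝ} (hη : 0 < η) :
    ∀ᶠ t in 𝓝[>] (0 : ℝ), ∀ (ρ : ℝ → ProbabilityMeasure (Space d)) (v : ℝ → VField d H),
      IsConnecting (π 0) (π t) ρ v → energy v = steinDistSq H (π 0) (π t) → energy v < ⊤ →
        ∫ s in Icc (0 : ℝ) 1, ‖t⁻¹ • v s - w 0‖ ^ 2 ≤ η := by
  obtain ⟨-, ψ, u, hψ, hu, -, hlim⟩ := hw
  set W := ‖w 0‖ with hW
  set B := √(W ^ 2 + 1) with hB
  have hκ0 : 0 ≤ κ := (norm_nonneg _).trans (hκ 0)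
  have hW0 : 0 ≤ W := norm_nonneg _
  have hB0 : 0 ≤ B := Real.sqrt_nonneg _
  -- Order of choices: n, then δ, then M (depending on both), then t. Five errors of η/5 are summed
  -- at the end: graph approximation, mollification (δ), drift of `ρ s`, the increment quotient (2 ·
  -- η/10), and excess energy.
  obtain ⟨n, hn⟩ : ∃ n, (2 * W + 2 * B) * ‖w 0 - u n‖ < η / 5 := by
    have h1 : Tendsto (fun n => (2 * W + 2 * B) * ‖w 0 - u n‖) atTop (𝓝 0) := by
      simpa using ((tendsto_const_nhds (x := w 0)).sub hlim).norm.const_mul (2 * W + 2 * B)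
    exact (h1.eventually (gt_mem_nhds (by positivity))).exists
  have hun := (hu n).eq_kernelGrad hcf hH (hψ n)
  obtain ⟨δ, hδ, hδη⟩ : ∃ δ : ℝ, 0 < δ ∧ 2 * B * δ < η / 5 := by
    refine ⟨η / (5 * (2 * B + 1)), by positivity, ?_⟩
    rw [mul_div_assoc', div_lt_div_iff₀ (by positivity) (by norm_num)]
    nlinarith
  obtain ⟨M, hM0, hM⟩ := exists_norm_integral_sub_le (continuous_gradFeature hcf (hψ n))
    (hasCompactSupport_gradFeature (hψ n)) hδ
  have hsmall : ∀ᶠ t in 𝓝[>] (0 : ℝ), 2 * B * (M * (κ * (t * B))) < η / 5 := by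
    have : Continuous fun t : ℝ => 2 * B * (M * (κ * (t * B))) := by fun_prop
    refine (this.tendsto' 0 0 (by simp)).mono_left nhdsWithin_le_nhds |>.eventually
      (gt_mem_nhds (by positivity))
  have hinc : ∀ᶠ t in 𝓝[>] (0 : ℝ), inner ℝ (w 0) (u n) - η / 10 <
      ((∫ x, ψ n x ∂(π t : Measure (Space d))) - ∫ x, ψ n x ∂(π 0 : Measure (Space d))) / t := by
    have h1 := (hSP 0 ⟨by linarith, hε⟩ (ψ n) (hψ n)).tendsto_slope_zero_right
    rw [fluxPairing_eq_inner hcf (hψ n), ← hun] at h1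
    filter_upwards [h1.eventually (lt_mem_nhds (sub_lt_self _ (by positivity : 0 < η / 10)))]
      with t ht
    rwa [zero_add, smul_eq_mul, ← div_eq_inv_mul] at ht
  filter_upwards [self_mem_nhdsWithin, hsmall, hinc,
    -- The 1 in the minimum keeps R / t ≤ B for a `B` fixed before η is used.
    eventually_steinDistSq_le hκ hcf hε hSP hcont (η := min 1 (η / 5)) (by positivity)]
    with t (ht : 0 < t) ht1 ht2 ht3 ρ v hc hv hE
  rw [← hv] at ht3
  set R := √(energy v).toReal with hR
  have hR0 : 0 ≤ R := Real.sqrt_nonneg _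
  have hr2 : (R / t) ^ 2 ≤ W ^ 2 + min 1 (η / 5) := by
    rw [div_pow, hR, Real.sq_sqrt ENNReal.toReal_nonneg, div_le_iff₀ (by positivity)]
    linarith
  have hrB : R / t ≤ B := Real.le_sqrt_of_sq_le (hr2.trans (by gcongr; exact min_le_left _ _))
  have hRB : R ≤ t * B := by rwa [div_le_iff₀' ht] at hrB
  have key := hc.integral_sq_norm_sub_le hcf hE (hψ n) (u := u n) (u₀ := w 0)
    (c := δ + M * (κ * R)) (fun s hs => by
      rw [hun]
      exact hM _ _ _ fun f hf K hK => hc.abs_integral_sub_le hκ hE hs hf hK) ht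
  refine key.trans ?_
  have h1 : (‖w 0 - u n‖ + (δ + M * (κ * R))) * (R / t) ≤
      (‖w 0 - u n‖ + (δ + M * (κ * (t * B)))) * B := by gcongr
  have h2 : W ^ 2 - W * ‖w 0 - u n‖ ≤ inner ℝ (w 0) (u n) := by
    have h3 : inner ℝ (w 0) (u n) = W ^ 2 - inner ℝ (w 0) (w 0 - u n) := by
      rw [inner_sub_right, real_inner_self_eq_norm_sq]; ring
    have h4 := real_inner_le_norm (w 0) (w 0 - u n)
    linarith
  have h5 := min_le_right 1 (η / 5)
  linarith

lemma norm_sub_le_of_isFlow {κ : ℝ} (hκ : ∀ x : Space d, ‖feature H x‖ ≤ κ)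
    {μ ν : ProbabilityMeasure (Space d)} {ρ : ℝ → ProbabilityMeasure (Space d)}
    {v : ℝ → VField d H} (hc : IsConnecting μ ν ρ v) (hE : energy v < ⊤)
    {X : ℝ → Space d}
    (hX : ∀ s ∈ Icc (0 : ℝ) 1, X s - X 0 = ∫ r in (0 : ℝ)..s, (v r).eval (X r))
    {s : ℝ} (hs : s ∈ Icc (0 : ℝ) 1) : ‖X s - X 0‖ ≤ κ * √(energy v).toReal := by
  have hκ0 : 0 ≤ κ := (norm_nonneg _).trans (hκ 0)
  have hi := (memLp_of_energy_lt_top hc.measurable hE).integrable one_le_two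
  rw [hX s hs]
  refine (norm_intervalIntegral_le (f := fun r => (v r).eval (X r)) (g := fun r => κ * ‖v r‖)
    (hi.norm.const_mul _) (fun r _ => norm_eval_le hκ _ _) hs).trans ?_
  rw [integral_const_mul]
  gcongr
  exact integral_norm_le_sqrt_energy hc.measurable hE

end Minimizer

/-! ### Integral form of the flow equation -/

section Flow

variable {d : ℕ} {H : Type*} [NormedAddCommGroup H] [InnerProductSpace ℝ H]
  [RKHS ℝ H (Space d) ℝ]

lemma IsCb1.continuousOn_eval {v : ℝ → VField d H} (hv : IsCb1 v) {X : ℝ → Space d}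
    (hX : ContinuousOn X (Icc 0 1)) : ContinuousOn (fun s => (v s).eval (X s)) (Icc 0 1) :=
  hv.1.continuousOn.comp (continuousOn_id.prodMk hX) fun _ hs => ⟨hs, mem_univ _⟩

lemma sub_eq_integral_of_isFlow {v : ℝ → VField d H} (hv : IsCb1 v) {X : ℝ → Space d}
    (hX : ∀ t ∈ Icc (0 : ℝ) 1, HasDerivWithinAt X ((v t).eval (X t)) (Icc (0 : ℝ) 1) t)
    {s : ℝ} (hs : s ∈ Icc (0 : ℝ) 1) : X s - X 0 = ∫ r in (0 : ℝ)..s, (v r).eval (X r) := by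
  have hXc : ContinuousOn X (Icc 0 1) := fun t ht => (hX t ht).continuousWithinAt
  have hsub : Icc 0 s ⊆ Icc (0 : ℝ) 1 := Icc_subset_Icc_right hs.2
  refine (intervalIntegral.integral_eq_sub_of_hasDeriv_right_of_le hs.1 (hXc.mono hsub)
    (fun r hr => ?_) ?_).symm
  · have hr' : r ∈ Ioo (0 : ℝ) 1 := ⟨hr.1, hr.2.trans_le hs.2⟩
    exact ((hX r (Ioo_subset_Icc_self hr')).hasDerivAt (Icc_mem_nhds hr'.1 hr'.2)).hasDerivWithinAt
  · refine ContinuousOn.intervalIntegrable ?_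
    rw [uIcc_of_le hs.1]
    exact (hv.continuousOn_eval hXc).mono hsub

end Flow

end SteinTransport

end

theorem proposition6 {d : ℕ} {H : Type*} [NormedAddCommGroup H] [InnerProductSpace ℝ H]
    [CompleteSpace H] [RKHS ℝ H (Space d) ℝ]
    (k : Space d → Space d → ℝ) (hk : IsBoundedC1Kernel k) (hH : IsRKHSOf d H k)
    (ε : ℝ) (hε : 0 < ε)
    (π : ℝ → ProbabilityMeasure (Space d))
    (hfin : ∀ t ∈ Ioo (-ε) ε, steinDist H (π 0) (π t) < ⊤)
    (hLip : ∃ L : ℝ≥0,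
      LipschitzOnWith L (fun t => (steinDist H (π 0) (π t)).toReal) (Ioo (-ε) ε))
    (F : ℝ → Space d → Space d)
    (hF : ∀ t ∈ Ioo (-ε) ε, IsSteinOTMap H (π 0) (π t) (F t))
    (hFuniq : ∀ t ∈ Ioo (-ε) ε, ∀ G : Space d → Space d,
      IsSteinOTMap H (π 0) (π t) G → G = F t)
    (φ : ℝ → Space d → ℝ) (w : ℝ → VField d H)
    (hw : ∀ t ∈ Ioo (-ε) ε, IsKernelGradient k (π t) (φ t) (w t))
    (hSP : ∀ t ∈ Ioo (-ε) ε, TransportEqAt π (w t) t)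
    (hcont : ContinuousOn w (Ioo (-ε) ε)) :
    ∀ x : Space d,
      Tendsto (fun t : ℝ => t⁻¹ • (F t x - x)) (𝓝[>] 0) (𝓝 ((w 0).eval x)) := by
  intro x
  obtain ⟨κ, hκ0, hκ⟩ := exists_norm_feature_le hk hH
  have hcf := continuous_feature hk hH
  rw [Metric.tendsto_nhds]
  intro θ hθ
  obtain ⟨δ, hδ, hwδ⟩ := Metric.continuousAt_iff.1
    ((continuous_eval hcf (w 0)).continuousAt (x := x)) (θ / 3) (by positivity)
  -- The square is undone by Cauchy–Schwarz in time; κ + 1 avoids division by zero when κ = 0.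
  set η := (θ / (3 * (κ + 1))) ^ 2 with hη
  set B := √(‖w 0‖ ^ 2 + 1) with hB
  have hsmall : ∀ᶠ t in 𝓝[>] (0 : ℝ), κ * (t * B) < δ := by
    have : Continuous fun t : ℝ => κ * (t * B) := by fun_prop
    exact (this.tendsto' 0 0 (by simp)).mono_left nhdsWithin_le_nhds |>.eventually
      (gt_mem_nhds hδ)
  filter_upwards [Ioo_mem_nhdsGT hε, hsmall,
    eventually_steinDistSq_le hκ hcf hε hSP hcont one_pos,
    eventually_integral_sq_norm_sub_le hκ hcf hH hε (hw 0 ⟨by linarith, hε⟩) hSP hcont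
      (show 0 < η by positivity)] with t ht ht1 ht2 ht3
  have ht0 : 0 < t := ht.1
  obtain ⟨hfint, ρ, v, -, hv, hc, hopt, hflow⟩ := hF t ⟨by linarith, ht.2⟩
  have hE : energy v < ⊤ := hopt ▸ hfint
  have hdev := ht3 ρ v hc hopt hE
  obtain ⟨X, hX0, hX, hFX⟩ := hflow x
  have hXint := fun s hs => sub_eq_integral_of_isFlow hv hX (s := s) hs
  have hR : √(energy v).toReal ≤ t * B := by
    refine Real.sqrt_le_iff.2 ⟨by positivity, ?_⟩
    rw [mul_pow, hB, Real.sq_sqrt (by positivity), hopt]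
    exact ht2
  have hXδ : ∀ s ∈ Icc (0 : ℝ) 1, dist (X s) x < δ := fun s hs => by
    rw [dist_eq_norm, ← hX0]
    exact (norm_sub_le_of_isFlow hκ hc hE hXint hs).trans_lt
      ((mul_le_mul_of_nonneg_left hR hκ0).trans_lt ht1)
  have hLp : MemLp (fun s => t⁻¹ • v s - w 0) 2 (volume.restrict (Icc (0 : ℝ) 1)) :=
    ((memLp_of_energy_lt_top hc.measurable hE).const_smul t⁻¹).sub (memLp_const _)
  have hmean : ∫ s in Icc (0 : ℝ) 1, ‖t⁻¹ • v s - w 0‖ ≤ θ / (3 * (κ + 1)) :=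
    le_of_sq_le_sq ((sq_integral_norm_le hLp).trans hdev) (by positivity)
  have hXc : ContinuousOn X (Icc 0 1) := fun s hs => (hX s hs).continuousWithinAt
  have hvi : IntervalIntegrable (fun s => (v s).eval (X s)) volume 0 1 := by
    refine ContinuousOn.intervalIntegrable ?_
    rw [uIcc_of_le zero_le_one]
    exact hv.continuousOn_eval hXc
  have hrepr : t⁻¹ • (F t x - x) - (w 0).eval x =
      ∫ s in (0 : ℝ)..1, (t⁻¹ • (v s).eval (X s) - (w 0).eval x) := by
    rw [intervalIntegral.integral_sub (f := fun s => t⁻¹ • (v s).eval (X s))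
        (hvi.smul t⁻¹) intervalIntegrable_const,
      intervalIntegral.integral_smul, ← hXint 1 (by simp), hFX, hX0]
    simp
  have hi : Integrable (fun s => ‖t⁻¹ • v s - w 0‖) (volume.restrict (Icc (0 : ℝ) 1)) :=
    (hLp.integrable one_le_two).norm
  rw [dist_eq_norm, hrepr]
  calc ‖∫ s in (0 : ℝ)..1, (t⁻¹ • (v s).eval (X s) - (w 0).eval x)‖
      ≤ ∫ s in Icc (0 : ℝ) 1, (κ * ‖t⁻¹ • v s - w 0‖ + θ / 3) := by
        refine norm_intervalIntegral_le ((hi.const_mul κ).add (integrable_const _))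
          (fun s hs => ?_) (by simp)
        -- Velocity error at the moving point, controlled in mean, plus displacement of the point,
        -- controlled by continuity of `w 0` at x.
        have e : t⁻¹ • (v s).eval (X s) - (w 0).eval x =
            (t⁻¹ • v s - w 0).eval (X s) + ((w 0).eval (X s) - (w 0).eval x) := by
          rw [eval_sub, eval_smul]; abel
        rw [e]
        refine (norm_add_le _ _).trans (add_le_add (norm_eval_le hκ _ _) ?_)
        rw [← dist_eq_norm]
        exact (hwδ (hXδ s hs)).le
    _ = κ * (∫ s in Icc (0 : ℝ) 1, ‖t⁻¹ • v s - w 0‖) + θ / 3 := by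
        rw [integral_add (hi.const_mul κ) (integrable_const _), integral_const_mul]
        simp
    _ ≤ κ * (θ / (3 * (κ + 1))) + θ / 3 := by gcongr
    _ < θ := by
        have : κ * (θ / (3 * (κ + 1))) ≤ θ / 3 := by
          rw [mul_div_assoc', div_le_div_iff₀ (by positivity) (by norm_num)]
          nlinarith
        linarith
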